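/- Let $E$ be a finite set and $\mathcal L\subseteq 2^E$. For $e\in E$ the toggle $t_e:\mathcal L\to\mathcal L$ is given by $t_e(X)=X\cup\{e\}$ if $e\notin X$ and $X\cup\{e\}\in\mathcal L$, by $t_e(X)=X\setminus\{e\}$ if $e\in X$ and $X\setminus\{e\}\in\mathcal L$, and by $t_e(X)=X$ otherwise. Each $t_e$ is an involution, and the toggle group $T(\mathcal L)$ is the subgroup of the symmetric group $\mathfrak S_{\mathcal L}$ generated by $\{t_e\mid e\in E\}$. The family $\mathcal L$ is called toggle-alternating if $T(\mathcal L)$ contains the alternating group $A_{\mathcal L}$. The ordinal sum $P_1\oplus P_2$ of two posets is the poset on the disjoint union of $P_1$ and $P_2$ which keeps the orders of $P_1$ and $P_2$ and in which every element of $P_1$ is less than every element of $P_2$. Let $P$ be a finite poset and let $\mathcal C(P)\subseteq 2^P$ be the family of its chains, that is, of its sets of mutually comparable elements (including $\emptyset$). 1. If $P=P_1\oplus P_2$, then $T(\mathcal C(P))=T(\mathcal C(P_1))\times T(\mathcal C(P_2))$; precisely, $(C_1,C_2)\mapsto C_1\cup C_2$ is a bijection $\mathcal C(P_1)\times\mathcal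 C(P_2)\to\mathcal C(P)$, and there is a group isomorphism $T(\mathcal C(P))\to T(\mathcal C(P_1))\times T(\mathcal C(P_2))$, $g\mapsto(g_1,g_2)$, such that $g(C_1\cup C_2)=g_1(C_1)\cup g_2(C_2)$ for all $g\in T(\mathcal C(P))$, $C_1\in\mathcal C(P_1)$ and $C_2\in\mathcal C(P_2)$. 2. If $P$ is not the ordinal sum of two nonempty posets, then $\mathcal C(P)$ is toggle-alternating. -/

import Mathlib

namespace ToggleGroups

universe u

open Classical in
/-- The toggle `t_e : L → L` of an element `e` of the ground set, as a function. -/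
noncomputable def toggleFun {E : Type u} (L : Set (Set E)) (e : E) (X : L) : L :=
  if h : e ∉ X.1 ∧ X.1 ∪ {e} ∈ L then ⟨X.1 ∪ {e}, h.2⟩
  else if h : e ∈ X.1 ∧ X.1 \ {e} ∈ L then ⟨X.1 \ {e}, h.2⟩
  else X

theorem toggleFun_involutive {E : Type u} (L : Set (Set E)) (e : E) :
    Function.Involutive (toggleFun L e) := by
  rintro ⟨X, hX⟩
  by_cases he : e ∈ X
  · by_cases h : X \ {e} ∈ L
    · simp [toggleFun, he, h, hX]
    · simp [toggleFun, he, h]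
  · by_cases h : insert e X ∈ L
    · simp [toggleFun, he, h, hX]
    · simp [toggleFun, he, h]

/-- The toggle `t_e` as an element of the symmetric group on `L`. -/
noncomputable def toggle {E : Type u} (L : Set (Set E)) (e : E) : Equiv.Perm L :=
  (toggleFun_involutive L e).toPerm

/-- The toggle group `T(L)`: the subgroup of the symmetric group on `L` generated by all toggles. -/
def toggleGroup {E : Type u} (L : Set (Set E)) : Subgroup (Equiv.Perm L) :=
  Subgroup.closure (Set.range (toggle L))

open Classical in
/-- `L` is toggle-alternating if `T(L)` contains the alternating group on `L`. -/
def ToggleAlternating {E : Type u} [Finite E] (L : Set (Set E)) : Prop :=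
  letI : Fintype L := Fintype.ofFinite L
  alternatingGroup L ≤ toggleGroup L

/-- The family of all chains (sets of mutually comparable elements) of a poset. -/
def chains (P : Type u) [PartialOrder P] : Set (Set P) :=
  {C | IsChain (· ≤ ·) C}

/-- `P` is an ordinal sum of two nonempty posets. The lexicographic sum `P₁ ⊕ₗ P₂` is the ordinal
sum: every element of `P₁` is below every element of `P₂`. -/
def IsOrdinalSum (P : Type u) [PartialOrder P] : Prop :=
  ∃ (P₁ P₂ : Type u) (_ : PartialOrder P₁) (_ : PartialOrder P₂),
    Nonempty P₁ ∧ Nonempty P₂ ∧ Nonempty (P ≃o P₁ ⊕ₗ P₂)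

end ToggleGroups

/-! Part 1: whether a chain stays a chain when an element of one summand is toggled depends only on
its trace on that summand, so each generator acts in one coordinate.

Part 2: chains are the independent sets of the incomparability graph, which is connected when `P` is
nonempty and not an ordinal sum. So it suffices to treat connected graphs, by induction on the
number of vertices. A dominating vertex gives a transposition in a primitive group, hence the full
symmetric group. Otherwise delete a non-cut vertex `v`. The independent sets avoiding `v` fill more
than half of the family, and by induction every even permutation of them is induced by the toggle
group `H`. Simplicity of the alternating group upgrades "induced by" to "extended by the identity
lies in `H`" (`viaEmbedding_mem_of_lift`). Then `H` contains a 3-cycle and is primitive, and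
Jordan's theorem applies (`alternatingGroup_le_of_viaEmbedding_mem`). -/

namespace ToggleGroups

open MulAction
open scoped Pointwise

/-! ### Permutation groups: from a large subset to the whole set -/

section PermutationGroups

variable {α β : Type*}

theorem apply_mem_of_isBlock {H : Subgroup (Equiv.Perm α)} {B : Set α} (hB : IsBlock H B)
    {g : Equiv.Perm α} (hg : g ∈ H) {x y : α} (hx : x ∈ B) (hgx : g x ∈ B) (hy : y ∈ B) :
    g y ∈ B := by
  have h : (⟨g, hg⟩ : H) • B = B := hB.smul_eq_of_mem hx hgx
  rw [← h]
  exact ⟨y, hy, rfl⟩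

/-- If every even permutation of `β` is induced by some element of `H` and `β` fills more than half
of `α`, then `H` contains the even permutations of `β` extended by the identity. -/
theorem viaEmbedding_mem_of_lift [Fintype α] [Fintype β] [DecidableEq β]
    (ι : β ↪ α) (H : Subgroup (Equiv.Perm α))
    (hcard : 5 ≤ Fintype.card β) (hhalf : Fintype.card α < 2 * Fintype.card β)
    (hlift : ∀ σ ∈ alternatingGroup β, ∃ h ∈ H, ∀ x, h (ι x) = ι (σ x))
    {σ : Equiv.Perm β} (hσ : σ ∈ alternatingGroup β) : σ.viaEmbedding ι ∈ H := by
  classical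
  have : Nontrivial β := Fintype.one_lt_card_iff_nontrivial.1 (by lia)
  choose! f hfH hf using hlift
  let N : Subgroup (alternatingGroup β) :=
    (H.comap (Equiv.Perm.viaEmbeddingHom ι)).subgroupOf (alternatingGroup β)
  have hN : N.Normal := by
    refine ⟨fun n hn g => ?_⟩
    have hn' : Equiv.Perm.viaEmbedding n.1 ι ∈ H := hn
    change Equiv.Perm.viaEmbedding (g.1 * n.1 * g.1⁻¹) ι ∈ H
    -- The lift `f g` preserves the range of `ι`, so conjugating by it acts there as conjugation by
    -- `g` and leaves the identity outside.
    have key : Equiv.Perm.viaEmbedding (g.1 * n.1 * g.1⁻¹) ι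
        = f g.1 * Equiv.Perm.viaEmbedding n.1 ι * (f g.1)⁻¹ := by
      rw [eq_mul_inv_iff_mul_eq]
      ext x
      simp only [Equiv.Perm.mul_apply]
      by_cases hx : x ∈ Set.range ι
      · obtain ⟨y, rfl⟩ := hx
        simp [hf g.1 g.2, Equiv.Perm.viaEmbedding_apply]
      · rw [Equiv.Perm.viaEmbedding_apply_of_notMem _ _ x hx,
          Equiv.Perm.viaEmbedding_apply_of_notMem]
        rintro ⟨y, hy⟩
        refine hx ⟨g.1⁻¹ y, ?_⟩
        apply (f g.1).injective
        rw [hf g.1 g.2, ← hy]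
        simp
    rw [key]
    exact H.mul_mem (H.mul_mem (hfH _ g.2) hn') (H.inv_mem (hfH _ g.2))
  have : IsSimpleGroup (alternatingGroup β) := alternatingGroup.isSimpleGroup (by simpa using hcard)
  rcases hN.eq_bot_or_eq_top with h | h
  -- If `N` is trivial, a lift is determined by its action off the range of `ι`: two even
  -- permutations whose lifts agree there differ by an element of `N`. This embeds the alternating
  -- group of `β` into a symmetric group on fewer than `card β` points.
  · exfalso
    have hmem : ∀ g : alternatingGroup β, ∀ x, f g.1 x ∉ Set.range ι ↔ x ∉ Set.range ι := by
      refine fun g x => not_congr ⟨?_, ?_⟩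
      · rintro ⟨y, hy⟩
        refine ⟨g.1⁻¹ y, (f g.1).injective ?_⟩
        rw [hf g.1 g.2, ← hy]
        simp
      · rintro ⟨y, rfl⟩
        exact ⟨g.1 y, (hf g.1 g.2 y).symm⟩
    let r : alternatingGroup β → Equiv.Perm {x // x ∉ Set.range ι} := fun g =>
      (f g.1).subtypePerm (hmem g)
    have hr : Function.Injective r := by
      intro g g' hgg
      have h1 : g * g'⁻¹ ∈ N := by
        change Equiv.Perm.viaEmbedding (g.1 * g'.1⁻¹) ι ∈ H
        have key : Equiv.Perm.viaEmbedding (g.1 * g'.1⁻¹) ι = f g.1 * (f g'.1)⁻¹ := by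
          rw [eq_mul_inv_iff_mul_eq]
          ext x
          simp only [Equiv.Perm.mul_apply]
          by_cases hx : x ∈ Set.range ι
          · obtain ⟨y, rfl⟩ := hx
            simp [hf g.1 g.2, hf g'.1 g'.2, Equiv.Perm.viaEmbedding_apply]
          · rw [Equiv.Perm.viaEmbedding_apply_of_notMem _ _ _ ((hmem g' x).2 hx)]
            have := congrArg (fun p => (p ⟨x, hx⟩).1) hgg
            simpa [r] using this.symm
        rw [key]
        exact H.mul_mem (hfH _ g.2) (H.inv_mem (hfH _ g'.2))
      rw [h, Subgroup.mem_bot] at h1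
      exact mul_inv_eq_one.1 h1
    have h1 := Nat.card_le_card_of_injective r hr
    have h2 := two_mul_nat_card_alternatingGroup (α := β)
    rw [Nat.card_perm] at h1 h2
    have h3 : Nat.card {x // x ∉ Set.range ι} < Nat.card β := by
      have := Set.ncard_add_ncard_compl (Set.range ι)
      rw [← Set.image_univ, Set.ncard_image_of_injective _ ι.injective, Set.ncard_univ,
        Nat.card_eq_fintype_card, Nat.card_eq_fintype_card, Set.image_univ] at this
      have h4 : Nat.card {x // x ∉ Set.range ι} = (Set.range ι)ᶜ.ncard := rfl
      rw [h4, Nat.card_eq_fintype_card]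
      lia
    rw [Nat.card_eq_fintype_card (α := β)] at h2 h3
    obtain ⟨m, hm⟩ : ∃ m, Fintype.card β = m + 1 := ⟨Fintype.card β - 1, by lia⟩
    rw [hm] at h2 h3 hcard
    have h5 := Nat.factorial_le (Nat.le_of_lt_succ h3)
    rw [Nat.factorial_succ] at h2
    have h6 := Nat.factorial_pos m
    -- With `card β = m + 1`, the embedding gives `(m + 1)! ≤ 2 * m!`, which fails for `m + 1 ≥ 5`.
    nlinarith
  · have : (⟨σ, hσ⟩ : alternatingGroup β) ∈ N := by rw [h]; trivial
    exact this

/-- A transitive permutation group containing the alternating group of a subset `β` that fills more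
than half of `α` contains the alternating group of `α`. -/
theorem alternatingGroup_le_of_viaEmbedding_mem [Fintype α] [DecidableEq α]
    [Fintype β] [DecidableEq β] (ι : β ↪ α) (H : Subgroup (Equiv.Perm α)) [IsPretransitive H α]
    (hcard : 3 ≤ Fintype.card β) (hhalf : Fintype.card α < 2 * Fintype.card β)
    (hH : ∀ σ ∈ alternatingGroup β, σ.viaEmbedding ι ∈ H) : alternatingGroup α ≤ H := by
  have hthree : ∀ a b c : β, a ≠ b → a ≠ c → b ≠ c →
      ∃ g ∈ H, g (ι a) = ι b ∧ g (ι b) = ι c ∧ g (ι c) = ι a ∧ ∀ x ∉ Set.range ι, g x = x := by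
    intro a b c hab hac hbc
    refine ⟨(Equiv.swap a b * Equiv.swap b c).viaEmbedding ι, hH _ ?_, ?_, ?_, ?_, fun x hx =>
      Equiv.Perm.viaEmbedding_apply_of_notMem _ _ _ hx⟩
    · rw [Equiv.Perm.mem_alternatingGroup]
      simp [Equiv.Perm.sign_swap hab, Equiv.Perm.sign_swap hbc]
    · rw [Equiv.Perm.viaEmbedding_apply]
      simp [Equiv.swap_apply_of_ne_of_ne hab hac]
    · rw [Equiv.Perm.viaEmbedding_apply]
      simp [Equiv.swap_apply_of_ne_of_ne hac.symm hbc.symm]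
    · rw [Equiv.Perm.viaEmbedding_apply]
      simp
  obtain ⟨a, b, c, hab, hac, hbc⟩ := Fintype.two_lt_card_iff.1 hcard
  have hprim : IsPreprimitive H α := by
    refine IsPreprimitive.of_isTrivialBlock_base (ι a) fun {B} haB hB => ?_
    by_cases h : ∃ d, d ≠ a ∧ ι d ∈ B
    · obtain ⟨d, hda, hdB⟩ := h
      right
      have hsub : Set.range ι ⊆ B := by
        rintro _ ⟨e, rfl⟩
        by_cases hea : e = a
        · rwa [hea]
        by_cases hed : e = d
        · rwa [hed]
        -- The 3-cycle `d → a → e` maps a point of `B` into `B`, hence preserves `B` and puts `ι e`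
        -- in it.
        obtain ⟨g, hg, h1, h2, -, -⟩ := hthree d a e hda (Ne.symm hed) (Ne.symm hea)
        rw [← h2]
        exact apply_mem_of_isBlock hB hg hdB (h1 ▸ haB) haB
      refine hB.eq_univ_of_card_lt ?_
      have := Set.ncard_le_ncard hsub
      rw [← Set.image_univ, Set.ncard_image_of_injective _ ι.injective, Set.ncard_univ,
        Nat.card_eq_fintype_card] at this
      rw [Nat.card_eq_fintype_card]
      lia
    · push Not at h
      left
      suffices hs : ∀ x ∈ B, x = ι a from fun x hx y hy => (hs x hx).trans (hs y hy).symm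
      intro x hx
      by_cases hxr : x ∈ Set.range ι
      · obtain ⟨d, rfl⟩ := hxr
        by_contra hne
        exact h d (fun e => hne (e ▸ rfl)) hx
      -- A point of `B` outside the range is fixed by this 3-cycle, so `B` is preserved and would
      -- contain `ι b`.
      · obtain ⟨g, hg, h1, -, -, hfix⟩ := hthree a b c hab hac hbc
        have := apply_mem_of_isBlock hB hg hx ((hfix x hxr).symm ▸ hx) haB
        rw [h1] at this
        exact absurd this (h b hab.symm)
  have h3 : Equiv.Perm.IsThreeCycle ((Equiv.swap a b * Equiv.swap a c).viaEmbedding ι) := by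
    have hvia : (Equiv.swap a b * Equiv.swap a c).viaEmbedding ι =
        Equiv.swap (ι a) (ι b) * Equiv.swap (ι a) (ι c) := by
      ext1 x
      by_cases hx : x ∈ Set.range ι
      · obtain ⟨y, rfl⟩ := hx
        simp [Equiv.Perm.viaEmbedding_apply, ι.injective.swap_apply]
      · have hne : ∀ d, x ≠ ι d := fun d h => hx ⟨d, h.symm⟩
        rw [Equiv.Perm.viaEmbedding_apply_of_notMem _ _ _ hx, Equiv.Perm.mul_apply,
          Equiv.swap_apply_of_ne_of_ne (hne a) (hne c),
          Equiv.swap_apply_of_ne_of_ne (hne a) (hne b)]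
    rw [hvia]
    exact Equiv.Perm.isThreeCycle_swap_mul_swap_same (ι.injective.ne hab) (ι.injective.ne hac)
      (ι.injective.ne hbc)
  refine Equiv.Perm.alternatingGroup_le_of_isPreprimitive_of_isThreeCycle_mem hprim h3 (hH _ ?_)
  exact (Equiv.Perm.isThreeCycle_swap_mul_swap_same hab hac hbc).mem_alternatingGroup

end PermutationGroups

/-! ### Toggles and their transport along injections -/

section Toggles

variable {E E' : Type*} {L : Set (Set E)} {L' : Set (Set E')}

theorem toggle_mem_toggleGroup (L : Set (Set E)) (e : E) : toggle L e ∈ toggleGroup L :=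
  Subgroup.subset_closure ⟨e, rfl⟩

theorem toggle_apply_of_notMem {e : E} {X : L} (he : e ∉ X.1) (h : insert e X.1 ∈ L) :
    toggle L e X = ⟨insert e X.1, h⟩ := by
  simp [toggle, toggleFun, he, h]

theorem toggle_apply_of_insert_notMem {e : E} {X : L} (he : e ∉ X.1) (h : insert e X.1 ∉ L) :
    toggle L e X = X := by
  simp [toggle, toggleFun, he, h]

theorem toggle_apply_of_mem {e : E} {X : L} (he : e ∈ X.1) (h : X.1 \ {e} ∈ L) :
    toggle L e X = ⟨X.1 \ {e}, h⟩ := by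
  simp [toggle, toggleFun, he, h]

theorem toggle_apply_of_diff_notMem {e : E} {X : L} (he : e ∈ X.1) (h : X.1 \ {e} ∉ L) :
    toggle L e X = X := by
  simp [toggle, toggleFun, he, h]

/-- Toggling commutes with the map `Z ↦ j '' Z ∪ Y` when that map reflects membership in the
families. -/
theorem toggle_image_union {j : E' → E} (hj : Function.Injective j) {Y : Set E}
    (hY : ∀ e, j e ∉ Y) (hL : ∀ Z, j '' Z ∪ Y ∈ L ↔ Z ∈ L') (X : L') (e : E') :
    (toggle L (j e) ⟨j '' X.1 ∪ Y, (hL _).2 X.2⟩).1 = j '' (toggle L' e X).1 ∪ Y := by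
  have hmem : j e ∈ j '' X.1 ∪ Y ↔ e ∈ X.1 := by simp [hj.mem_set_image, hY e]
  have hins : insert (j e) (j '' X.1 ∪ Y) = j '' insert e X.1 ∪ Y := by
    rw [Set.image_insert_eq, Set.insert_union]
  have hdiff : (j '' X.1 ∪ Y) \ {j e} = j '' (X.1 \ {e}) ∪ Y := by
    rw [Set.union_sdiff_distrib, Set.image_sdiff hj, Set.image_singleton,
      Set.sdiff_singleton_eq_self (hY e)]
  by_cases he : e ∈ X.1
  · by_cases h : X.1 \ {e} ∈ L'
    · rw [toggle_apply_of_mem he h, toggle_apply_of_mem (hmem.2 he) (by rwa [hdiff, hL])]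
      exact hdiff
    · rw [toggle_apply_of_diff_notMem he h,
        toggle_apply_of_diff_notMem (hmem.2 he) (by rwa [hdiff, hL])]
  · by_cases h : insert e X.1 ∈ L'
    · rw [toggle_apply_of_notMem he h, toggle_apply_of_notMem (mt hmem.1 he) (by rwa [hins, hL])]
      exact hins
    · rw [toggle_apply_of_insert_notMem he h,
        toggle_apply_of_insert_notMem (mt hmem.1 he) (by rwa [hins, hL])]

end Toggles

/-! ### Independent sets of connected graphs -/

section IndependentSets

variable {V : Type*}

/-- The family of independent sets of a graph. -/
def indepSets (G : SimpleGraph V) : Set (Set V) :=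
  {X | G.IsIndepSet X}

theorem empty_mem_indepSets (G : SimpleGraph V) : ∅ ∈ indepSets G :=
  Set.pairwise_empty _

theorem singleton_mem_indepSets (G : SimpleGraph V) (a : V) : {a} ∈ indepSets G :=
  Set.pairwise_singleton _ _

theorem mem_indepSets_of_subset {G : SimpleGraph V} {X Y : Set V} (hXY : X ⊆ Y)
    (hY : Y ∈ indepSets G) : X ∈ indepSets G :=
  Set.Pairwise.mono hXY hY

theorem notMem_indepSets_of_adj {G : SimpleGraph V} {X : Set V} {a b : V} (ha : a ∈ X)
    (hb : b ∈ X) (hab : G.Adj a b) : X ∉ indepSets G :=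
  fun h => h ha hb hab.ne hab

theorem exists_apply_empty_eq [Finite V] (G : SimpleGraph V) (X : indepSets G) :
    ∃ g ∈ toggleGroup (indepSets G), g ⟨∅, empty_mem_indepSets G⟩ = X := by
  obtain ⟨X, hX⟩ := X
  induction X, X.toFinite using Set.Finite.induction_on with
  | empty => exact ⟨1, one_mem _, rfl⟩
  | @insert a S ha _ ih =>
    have hS := mem_indepSets_of_subset (Set.subset_insert a S) hX
    obtain ⟨g, hg, hgS⟩ := ih hS
    refine ⟨toggle _ a * g, mul_mem (toggle_mem_toggleGroup _ a) hg, ?_⟩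
    rw [Equiv.Perm.mul_apply, hgS, toggle_apply_of_notMem ha hX]

theorem isPretransitive_toggleGroup_indepSets [Finite V] (G : SimpleGraph V) :
    IsPretransitive (toggleGroup (indepSets G)) (indepSets G) := by
  rw [isPretransitive_iff_base (⟨∅, empty_mem_indepSets G⟩ : indepSets G)]
  intro X
  obtain ⟨g, hg, h⟩ := exists_apply_empty_eq G X
  exact ⟨⟨g, hg⟩, h⟩

/-- A vertex adjacent to all others gives a transposition, and the toggle group is symmetric. -/
theorem toggleGroup_indepSets_eq_top [Finite V] {G : SimpleGraph V} {a : V}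
    (ha : ∀ b, b ≠ a → G.Adj a b) : toggleGroup (indepSets G) = ⊤ := by
  classical
  have := isPretransitive_toggleGroup_indepSets G
  let O : indepSets G := ⟨∅, empty_mem_indepSets G⟩
  let A : indepSets G := ⟨{a}, singleton_mem_indepSets G a⟩
  have hOA : O ≠ A := fun h => Set.singleton_ne_empty a (congrArg Subtype.val h).symm
  have hO : ∀ b, toggle (indepSets G) b O = ⟨{b}, singleton_mem_indepSets G b⟩ := by
    intro b
    rw [toggle_apply_of_notMem (Set.notMem_empty b)
      (by simpa [O] using singleton_mem_indepSets G b)]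
    simp [O]
  have hA : toggle (indepSets G) a A = O := by
    rw [toggle_apply_of_mem (Set.mem_singleton a) (by simpa [A] using empty_mem_indepSets G)]
    simp [A, O]
  -- An independent set containing `a` is `{a}`, and no other nonempty one can gain `a`.
  have hfix : ∀ X, X ≠ O → X ≠ A → toggle (indepSets G) a X = X := by
    intro X hXO hXA
    obtain ⟨b, hb⟩ : X.1.Nonempty := Set.nonempty_iff_ne_empty.2 fun h => hXO (Subtype.ext h)
    have haX : a ∉ X.1 := by
      intro haX
      refine hXA (Subtype.ext (Set.eq_singleton_iff_unique_mem.2 ⟨haX, fun c hc => ?_⟩))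
      by_contra hca
      exact X.2 haX hc (Ne.symm hca) (ha c hca)
    refine toggle_apply_of_insert_notMem haX
      (notMem_indepSets_of_adj (Set.mem_insert a _) (Set.mem_insert_of_mem a hb) (ha b ?_))
    rintro rfl
    exact haX hb
  have hswap : toggle (indepSets G) a = Equiv.swap O A := by
    ext1 X
    by_cases hXO : X = O
    · rw [hXO, hO, Equiv.swap_apply_left]
    by_cases hXA : X = A
    · rw [hXA, hA, Equiv.swap_apply_right]
    rw [hfix X hXO hXA, Equiv.swap_apply_of_ne_of_ne hXO hXA]
  have hprim : IsPreprimitive (toggleGroup (indepSets G)) (indepSets G) := by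
    refine IsPreprimitive.of_isTrivialBlock_base O fun {B} hOB hB => ?_
    rw [IsTrivialBlock, or_iff_not_imp_left, Set.not_subsingleton_iff]
    intro hnt
    have hAB : A ∈ B := by
      obtain ⟨X, hXB, hXO⟩ := hnt.exists_ne O
      by_cases hXA : X = A
      · exact hXA ▸ hXB
      have := apply_mem_of_isBlock hB (toggle_mem_toggleGroup _ a) hXB
        ((hfix X hXO hXA).symm ▸ hXB) hOB
      rwa [hO] at this
    -- Toggles at `b ≠ a` fix `{a}`, and the toggle at `a` swaps two members of `B`. So every
    -- generator preserves `B`, and transitivity makes `B` everything.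
    have htog : ∀ b, ∀ X ∈ B, toggle (indepSets G) b X ∈ B := by
      intro b X hX
      by_cases hba : b = a
      · subst hba
        exact apply_mem_of_isBlock hB (toggle_mem_toggleGroup _ b) hOB (by rwa [hO]) hX
      · refine apply_mem_of_isBlock hB (toggle_mem_toggleGroup _ b) hAB ?_ hX
        rwa [toggle_apply_of_insert_notMem (by simpa [A] using hba)]
        exact notMem_indepSets_of_adj (Set.mem_insert_of_mem b (Set.mem_singleton a))
          (Set.mem_insert b _) (ha b hba)
    have hinv : ∀ g ∈ toggleGroup (indepSets G), ∀ X ∈ B, g X ∈ B := by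
      intro g hg
      induction hg using Subgroup.closure_induction_left with
      | one => exact fun X hX => hX
      | mul_left x hx y _ ih =>
        obtain ⟨b, rfl⟩ := hx
        exact fun X hX => htog b _ (ih X hX)
      | inv_mul_cancel x hx y _ ih =>
        obtain ⟨b, rfl⟩ := hx
        exact fun X hX => htog b _ (ih X hX)
    refine Set.eq_univ_of_forall fun X => ?_
    obtain ⟨g, hg, rfl⟩ := exists_apply_empty_eq G X
    exact hinv g hg _ hOB
  exact Equiv.Perm.subgroup_eq_top_of_isPreprimitive_of_isSwap_mem hprim _ ⟨O, A, hOA, hswap⟩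
    (toggle_mem_toggleGroup _ a)

/-- The empty union puts this in the form required by `toggle_image_union` with `Y = ∅`. -/
theorem image_val_mem_indepSets (G : SimpleGraph V) (s : Set V) (Z : Set s) :
    Subtype.val '' Z ∪ ∅ ∈ indepSets G ↔ Z ∈ indepSets (G.induce s) := by
  rw [Set.union_empty]
  exact Subtype.val_injective.injOn.pairwise_image

/-- An independent set of an induced subgraph, seen as an independent set of the graph. -/
def indepSetsEmbedding (G : SimpleGraph V) (s : Set V) :
    indepSets (G.induce s) ↪ indepSets G where
  toFun X := ⟨Subtype.val '' X.1 ∪ ∅, (image_val_mem_indepSets G s X.1).2 X.2⟩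
  inj' X Y h := by
    have h' := congrArg Subtype.val h
    simp only [Set.union_empty] at h'
    exact Subtype.ext (Subtype.val_injective.image_injective h')

/-- On independent sets contained in `s`, the toggle of `G` at a vertex of `s` acts as the toggle of
the induced subgraph; words in toggles follow. -/
theorem exists_mem_toggleGroup_lift (G : SimpleGraph V) (s : Set V)
    {σ : Equiv.Perm (indepSets (G.induce s))} (hσ : σ ∈ toggleGroup (indepSets (G.induce s))) :
    ∃ g ∈ toggleGroup (indepSets G),
      ∀ X, g (indepSetsEmbedding G s X) = indepSetsEmbedding G s (σ X) := by
  induction hσ using Subgroup.closure_induction with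
  | mem x hx =>
    obtain ⟨e, rfl⟩ := hx
    exact ⟨toggle _ e.1, toggle_mem_toggleGroup _ _, fun X => Subtype.ext
      (toggle_image_union Subtype.val_injective (Set.notMem_empty ·.1)
        (image_val_mem_indepSets G s) X e)⟩
  | one => exact ⟨1, one_mem _, fun _ => rfl⟩
  | mul x y _ _ hx hy =>
    obtain ⟨g, hg, h⟩ := hx
    obtain ⟨g', hg', h'⟩ := hy
    exact ⟨g * g', mul_mem hg hg', fun X => by simp [h, h']⟩
  | inv x _ hx =>
    obtain ⟨g, hg, h⟩ := hx
    refine ⟨g⁻¹, inv_mem hg, fun X => ?_⟩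
    rw [Equiv.Perm.inv_eq_iff_eq, h]
    simp

/-- Recording whether `v ∈ X` together with `X` minus `v` is injective but misses the pair `(true,
{a})`, so the inequality is strict. -/
theorem card_indepSets_lt [Finite V] {G : SimpleGraph V} {v a : V} (hva : G.Adj v a) :
    Nat.card (indepSets G) < 2 * Nat.card (indepSets (G.induce {v}ᶜ)) := by
  classical
  have := Fintype.ofFinite (indepSets G)
  have := Fintype.ofFinite (indepSets (G.induce {v}ᶜ))
  let f : indepSets G → Bool × indepSets (G.induce {v}ᶜ) := fun X =>
    (decide (v ∈ X.1), ⟨Subtype.val ⁻¹' X.1, (image_val_mem_indepSets G _ _).1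
      (mem_indepSets_of_subset (by simp) X.2)⟩)
  have hf : Function.Injective f := by
    intro X Y h
    simp only [f, Prod.mk.injEq, decide_eq_decide, Subtype.mk.injEq] at h
    ext x
    by_cases hx : x = v
    · rw [hx, h.1]
    · exact Set.ext_iff.1 h.2 ⟨x, hx⟩
  have hlt := Fintype.card_lt_of_injective_of_notMem f hf
    (b := (true, ⟨{⟨a, hva.ne'⟩}, singleton_mem_indepSets _ _⟩)) (by
      rintro ⟨X, hX⟩
      simp only [f, Prod.mk.injEq, decide_eq_true_eq, Subtype.mk.injEq] at hX
      have haX : a ∈ X.1 := by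
        have : (⟨a, hva.ne'⟩ : ({v}ᶜ : Set V)) ∈ Subtype.val ⁻¹' X.1 := by rw [hX.2]; rfl
        exact this
      exact notMem_indepSets_of_adj hX.1 haX hva X.2)
  rw [Fintype.card_prod, Fintype.card_bool] at hlt
  simpa [Nat.card_eq_fintype_card] using hlt

theorem five_le_card_indepSets [Finite V] {G : SimpleGraph V} {a b c : V} (hab : a ≠ b)
    (hnab : ¬ G.Adj a b) (hac : a ≠ c) (hbc : b ≠ c) : 5 ≤ Nat.card (indepSets G) := by
  have hsub : ({∅, {a}, {b}, {c}, {a, b}} : Set (Set V)) ⊆ indepSets G := by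
    rintro X (rfl | rfl | rfl | rfl | rfl)
    · exact empty_mem_indepSets G
    · exact singleton_mem_indepSets G a
    · exact singleton_mem_indepSets G b
    · exact singleton_mem_indepSets G c
    · exact Set.pairwise_pair.2 fun _ => ⟨hnab, fun h => hnab h.symm⟩
  have hne : ∀ x : V, (∅ : Set V) ≠ {x} := fun x => (Set.singleton_ne_empty x).symm
  have hpair : ∀ {x y : V}, x ∈ ({a, b} : Set V) → x ≠ y → ({y} : Set V) ≠ {a, b} := by
    intro x y hx hxy h
    rw [← h] at hx
    exact hxy hx
  have h5 : ({∅, {a}, {b}, {c}, {a, b}} : Set (Set V)).ncard = 5 := by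
    rw [Set.ncard_insert_of_notMem, Set.ncard_insert_of_notMem, Set.ncard_insert_of_notMem,
      Set.ncard_pair (hpair (Set.mem_insert a _) hac)]
    · simp [hbc, hpair (Set.mem_insert a _) hab]
    · simp [hab, hac, hpair (Set.mem_insert_of_mem a (Set.mem_singleton b)) hab.symm]
    · simp [hne, (Set.insert_nonempty a {b}).ne_empty.symm]
  rw [← h5, Nat.card_coe_set_eq]
  exact Set.ncard_le_ncard hsub

theorem toggleAlternating_indepSets {V : Type*} [Finite V] {G : SimpleGraph V}
    (hG : G.Connected) : ToggleAlternating (indepSets G) := by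
  classical
  induction hn : Nat.card V using Nat.strong_induction_on generalizing V with
  | _ n ih =>
  by_cases hdom : ∃ a, ∀ b, b ≠ a → G.Adj a b
  · obtain ⟨a, ha⟩ := hdom
    rw [ToggleAlternating, toggleGroup_indepSets_eq_top ha]
    exact le_top
  push Not at hdom
  have : Nontrivial V := by
    obtain ⟨a⟩ := hG.nonempty
    obtain ⟨b, hb, -⟩ := hdom a
    exact ⟨b, a, hb⟩
  -- A non-cut vertex keeps the smaller graph connected, as the induction needs.
  obtain ⟨v, hv⟩ := hG.exists_connected_induce_compl_singleton_of_finite_nontrivial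
  have hcard : Nat.card ({v}ᶜ : Set V) < n := by
    rw [← hn, Nat.card_coe_set_eq, ← Set.ncard_univ]
    exact Set.ncard_lt_ncard (Set.ssubset_univ_iff.2 (by simp))
  have halt := ih _ hcard hv rfl
  obtain ⟨a, hva⟩ := hG.preconnected.exists_adj_of_nontrivial v
  obtain ⟨b, hba, hab⟩ := hdom a
  have hbv : b ≠ v := by
    rintro rfl
    exact hab hva.symm
  have : Nontrivial ({v}ᶜ : Set V) :=
    ⟨⟨a, hva.ne'⟩, ⟨b, hbv⟩, fun h => hba (congrArg Subtype.val h).symm⟩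
  obtain ⟨c, hc⟩ := hv.preconnected.exists_adj_of_nontrivial ⟨a, hva.ne'⟩
  -- In `G` minus `v`, take `a`, a non-neighbour `b` of `a`, and a neighbour `c` of `a`: the empty
  -- set, three singletons and `{a, b}` are independent.
  have h5 : 5 ≤ Nat.card (indepSets (G.induce {v}ᶜ)) :=
    five_le_card_indepSets (a := ⟨a, hva.ne'⟩) (b := ⟨b, hbv⟩) (c := c)
      (fun h => hba (congrArg Subtype.val h).symm) hab hc.ne (by
        rintro rfl
        exact hab hc)
  have hhalf := card_indepSets_lt hva
  have := isPretransitive_toggleGroup_indepSets G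
  let _ : Fintype (indepSets G) := Fintype.ofFinite _
  let _ : Fintype (indepSets (G.induce {v}ᶜ)) := Fintype.ofFinite _
  rw [Nat.card_eq_fintype_card] at h5
  rw [Nat.card_eq_fintype_card, Nat.card_eq_fintype_card] at hhalf
  exact alternatingGroup_le_of_viaEmbedding_mem (indepSetsEmbedding G {v}ᶜ) _ (by lia) hhalf
    fun σ hσ => viaEmbedding_mem_of_lift _ _ h5 hhalf
      (fun τ hτ => exists_mem_toggleGroup_lift G _ (halt hτ)) hσ

end IndependentSets

/-! ### Ordinal sums and the incomparability graph -/

section OrdinalSums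

variable {P : Type*} [PartialOrder P]

/-- The incomparability graph of a poset. -/
def incompGraph (P : Type*) [PartialOrder P] : SimpleGraph P where
  Adj a b := ¬ a ≤ b ∧ ¬ b ≤ a
  symm := ⟨fun _ _ h => ⟨h.2, h.1⟩⟩
  loopless := ⟨fun _ h => h.1 le_rfl⟩

theorem chains_eq_indepSets (P : Type*) [PartialOrder P] :
    chains P = indepSets (incompGraph P) := by
  ext C
  simp only [chains, IsChain, indepSets, incompGraph, SimpleGraph.isIndepSet_iff, Set.mem_ofPred_eq,
    not_and_or, not_not]

/-- A subset all of whose elements lie below its complement splits the poset as an ordinal sum. -/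
noncomputable def sumLexComplOrderIso (S : Set P) (hS : ∀ a ∈ S, ∀ b ∉ S, a < b) :
    P ≃o S ⊕ₗ (Sᶜ : Set P) :=
  open Classical in
  OrderIso.symm
    { toEquiv := ofLex.trans (Equiv.Set.sumCompl S)
      map_rel_iff' := by
        intro x y
        induction x using Lex.rec with | _ x =>
        induction y using Lex.rec with | _ y =>
        rcases x with x | x <;> rcases y with y | y
        · simp
        · simpa using (hS x.1 x.2 y.1 y.2).le
        · simpa using not_le_of_gt (hS y.1 y.2 x.1 x.2)
        · simp }

/-- The component `S` of a minimal element lies entirely below its complement, so a nonempty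
complement would split `P` as an ordinal sum. -/
theorem incompGraph_connected [Finite P] [Nonempty P] (hP : ¬ IsOrdinalSum P) :
    (incompGraph P).Connected := by
  obtain ⟨a, -, ha⟩ := exists_minimal_of_wellFoundedLT (fun _ : P => True)
    ⟨Classical.arbitrary P, trivial⟩
  let S : Set P := {x | (incompGraph P).Reachable a x}
  have hmin : ∀ b ∉ S, a < b := by
    intro b hb
    have hab : ¬ (incompGraph P).Adj a b := fun h => hb h.reachable
    have hne : a ≠ b := by
      rintro rfl
      exact hb (SimpleGraph.Reachable.refl a)
    simp only [incompGraph, not_and_or, not_not] at hab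
    rcases hab with h | h
    · exact lt_of_le_of_ne h hne
    · exact lt_of_le_of_ne (ha trivial h) hne
  have hS : ∀ x ∈ S, ∀ b ∉ S, x < b := by
    intro x hx b hb
    have hx' := (SimpleGraph.reachable_iff_reflTransGen _ _).1 hx
    induction hx' with
    | refl => exact hmin b hb
    | @tail y z hy hyz ih =>
      have hyS : y ∈ S := (SimpleGraph.reachable_iff_reflTransGen _ _).2 hy
      have hyb := ih hyS
      have hzb : ¬ (incompGraph P).Adj z b := fun h =>
        hb (SimpleGraph.Reachable.trans hx h.reachable)
      have hne : z ≠ b := by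
        rintro rfl
        exact hb hx
      simp only [incompGraph, not_and_or, not_not] at hzb
      rcases hzb with h | h
      · exact lt_of_le_of_ne h hne
      -- The relation "below `b`" propagates along edges: `y < b ≤ z` would make the adjacent `y`
      -- and `z` comparable.
      · exact absurd (hyb.le.trans h) hyz.1
  have huniv : ∀ x, x ∈ S := by
    by_contra! h
    obtain ⟨x, hx⟩ := h
    exact hP ⟨S, (Sᶜ : Set P), inferInstance, inferInstance, ⟨a, SimpleGraph.Reachable.refl a⟩,
      ⟨x, hx⟩, ⟨sumLexComplOrderIso S hS⟩⟩
  exact ⟨fun x y => (huniv x).symm.trans (huniv y)⟩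

theorem toggleAlternating_chains [Finite P] (hP : ¬ IsOrdinalSum P) :
    ToggleAlternating (chains P) := by
  classical
  rw [chains_eq_indepSets]
  cases isEmpty_or_nonempty P
  · intro g _
    have : Subsingleton (indepSets (incompGraph P)) := inferInstance
    rw [Subsingleton.elim g 1]
    exact one_mem _
  · exact toggleAlternating_indepSets (incompGraph_connected hP)

end OrdinalSums

/-! ### Product decomposition for ordinal sums -/

section Products

variable {P P₁ P₂ : Type*} [PartialOrder P] [PartialOrder P₁] [PartialOrder P₂]

theorem image_union_image_mem_chains (e : P ≃o P₁ ⊕ₗ P₂) (C₁ : Set P₁) (C₂ : Set P₂) :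
    (fun p => e.symm (Sum.inlₗ p)) '' C₁ ∪ (fun p => e.symm (Sum.inrₗ p)) '' C₂ ∈ chains P ↔
      C₁ ∈ chains P₁ ∧ C₂ ∈ chains P₂ := by
  constructor
  · intro h
    refine ⟨fun x hx y hy hxy => ?_, fun x hx y hy hxy => ?_⟩
    · simpa using h (Or.inl ⟨x, hx, rfl⟩) (Or.inl ⟨y, hy, rfl⟩) (by simpa using hxy)
    · simpa using h (Or.inr ⟨x, hx, rfl⟩) (Or.inr ⟨y, hy, rfl⟩) (by simpa using hxy)
  · rintro ⟨h₁, h₂⟩ _ (⟨x, hx, rfl⟩ | ⟨x, hx, rfl⟩) _ (⟨y, hy, rfl⟩ | ⟨y, hy, rfl⟩) hxy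
    · simpa using h₁ hx hy (fun h => hxy (h ▸ rfl))
    · exact Or.inl (by simp)
    · exact Or.inr (by simp)
    · simpa using h₂ hx hy (fun h => hxy (h ▸ rfl))

/-- Chains of an ordinal sum are pairs of chains of the summands. -/
noncomputable def chainsProdEquiv (e : P ≃o P₁ ⊕ₗ P₂) : chains P₁ × chains P₂ ≃ chains P :=
  Equiv.ofBijective
    (fun C => ⟨(fun p => e.symm (Sum.inlₗ p)) '' C.1.1 ∪ (fun p => e.symm (Sum.inrₗ p)) '' C.2.1,
      (image_union_image_mem_chains e _ _).2 ⟨C.1.2, C.2.2⟩⟩) <| by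
    constructor
    · rintro ⟨C₁, C₂⟩ ⟨D₁, D₂⟩ h
      have h' := Set.ext_iff.1 (congrArg Subtype.val h)
      refine Prod.ext (Subtype.ext (Set.ext fun x => ?_)) (Subtype.ext (Set.ext fun x => ?_))
      · simpa using h' (e.symm (Sum.inlₗ x))
      · simpa using h' (e.symm (Sum.inrₗ x))
    · rintro ⟨C, hC⟩
      have hunion : (fun p => e.symm (Sum.inlₗ p)) '' ((fun p => e.symm (Sum.inlₗ p)) ⁻¹' C) ∪
          (fun p => e.symm (Sum.inrₗ p)) '' ((fun p => e.symm (Sum.inrₗ p)) ⁻¹' C) = C := by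
        ext x
        obtain ⟨y, rfl⟩ := e.symm.surjective x
        induction y using Lex.rec with | _ y =>
        rcases y with y | y <;> simp [Sum.inlₗ, Sum.inrₗ]
      have hmem := (image_union_image_mem_chains e _ _).1 (hunion.symm ▸ hC)
      exact ⟨(⟨_, hmem.1⟩, ⟨_, hmem.2⟩), Subtype.ext hunion⟩

/-- Componentwise action of pairs of permutations of chains on the chains of an ordinal sum. -/
noncomputable def permProdHom (e : P ≃o P₁ ⊕ₗ P₂) :
    Equiv.Perm (chains P₁) × Equiv.Perm (chains P₂) →* Equiv.Perm (chains P) where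
  toFun g := (chainsProdEquiv e).permCongr (Equiv.prodCongr g.1 g.2)
  map_one' := by ext; simp
  map_mul' g h := by ext; simp [Prod.map]

theorem permProdHom_apply (e : P ≃o P₁ ⊕ₗ P₂)
    (g : Equiv.Perm (chains P₁) × Equiv.Perm (chains P₂)) (C : chains P₁ × chains P₂) :
    permProdHom e g (chainsProdEquiv e C) = chainsProdEquiv e (g.1 C.1, g.2 C.2) := by
  simp [permProdHom, Prod.map]

theorem permProdHom_injective (e : P ≃o P₁ ⊕ₗ P₂) : Function.Injective (permProdHom e) := by
  intro g h hgh
  have key : ∀ C : chains P₁ × chains P₂, (g.1 C.1, g.2 C.2) = (h.1 C.1, h.2 C.2) := fun C =>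
    (chainsProdEquiv e).injective (by rw [← permProdHom_apply, hgh, permProdHom_apply])
  refine Prod.ext (Equiv.ext fun C => ?_) (Equiv.ext fun C => ?_)
  · exact congrArg Prod.fst (key (C, ⟨∅, Set.pairwise_empty _⟩))
  · exact congrArg Prod.snd (key (⟨∅, Set.pairwise_empty _⟩, C))

theorem permProdHom_toggle_left (e : P ≃o P₁ ⊕ₗ P₂) (p : P₁) :
    permProdHom e (toggle (chains P₁) p, 1) = toggle (chains P) (e.symm (Sum.inlₗ p)) := by
  ext1 C
  obtain ⟨⟨C₁, C₂⟩, rfl⟩ := (chainsProdEquiv e).surjective C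
  rw [permProdHom_apply]
  refine Subtype.ext (Eq.symm ?_)
  refine toggle_image_union (j := fun p => e.symm (Sum.inlₗ p)) (fun x y h => by simpa using h)
    (by simp) (fun Z => ?_) C₁ p
  simp [image_union_image_mem_chains, C₂.2]

theorem permProdHom_toggle_right (e : P ≃o P₁ ⊕ₗ P₂) (p : P₂) :
    permProdHom e (1, toggle (chains P₂) p) = toggle (chains P) (e.symm (Sum.inrₗ p)) := by
  ext1 C
  obtain ⟨⟨C₁, C₂⟩, rfl⟩ := (chainsProdEquiv e).surjective C
  rw [permProdHom_apply]
  refine Subtype.ext (Eq.symm ?_)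
  -- Now the image of `C₁` is the fixed part `Y`, so the two sides of the union have to be
  -- exchanged.
  have := toggle_image_union (L := chains P) (L' := chains P₂)
    (j := fun p => e.symm (Sum.inrₗ p))
    (Y := (fun p => e.symm (Sum.inlₗ p)) '' C₁.1) (fun x y h => by simpa using h)
    (by simp) (fun Z => by rw [Set.union_comm]; simp [image_union_image_mem_chains, C₁.2]) C₂ p
  simp only [Set.union_comm _ ((fun p => e.symm (Sum.inlₗ p)) '' C₁.1)] at this
  exact this

/-- It is enough to look at generators: the toggles of `P` are exactly the images of toggles in one
coordinate paired with the identity in the other. -/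
theorem map_permProdHom (e : P ≃o P₁ ⊕ₗ P₂) :
    ((toggleGroup (chains P₁)).prod (toggleGroup (chains P₂))).map (permProdHom e) =
      toggleGroup (chains P) := by
  apply le_antisymm
  · have h₁ : toggleGroup (chains P₁) ≤
        (toggleGroup (chains P)).comap ((permProdHom e).comp (MonoidHom.inl _ _)) := by
      rw [toggleGroup, Subgroup.closure_le]
      rintro _ ⟨p, rfl⟩
      exact (permProdHom_toggle_left e p).symm.subst (motive := (· ∈ toggleGroup (chains P)))
        (toggle_mem_toggleGroup _ _)
    have h₂ : toggleGroup (chains P₂) ≤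
        (toggleGroup (chains P)).comap ((permProdHom e).comp (MonoidHom.inr _ _)) := by
      rw [toggleGroup, Subgroup.closure_le]
      rintro _ ⟨p, rfl⟩
      exact (permProdHom_toggle_right e p).symm.subst (motive := (· ∈ toggleGroup (chains P)))
        (toggle_mem_toggleGroup _ _)
    rintro _ ⟨⟨g₁, g₂⟩, ⟨hg₁, hg₂⟩, rfl⟩
    have : permProdHom e (g₁, g₂) = permProdHom e (g₁, 1) * permProdHom e (1, g₂) := by
      rw [← map_mul]
      simp
    rw [this]
    exact mul_mem (h₁ hg₁) (h₂ hg₂)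
  · rw [toggleGroup, Subgroup.closure_le]
    rintro _ ⟨x, rfl⟩
    obtain ⟨y, rfl⟩ := e.symm.surjective x
    induction y using Lex.rec with | _ y =>
    rcases y with p | p
    · exact ⟨(toggle _ p, 1), ⟨toggle_mem_toggleGroup _ p, one_mem _⟩, permProdHom_toggle_left e p⟩
    · exact ⟨(1, toggle _ p), ⟨one_mem _, toggle_mem_toggleGroup _ p⟩, permProdHom_toggle_right e p⟩

/-- The toggle group of the chains of an ordinal sum is the product of the toggle groups. -/
noncomputable def toggleGroupProdEquiv (e : P ≃o P₁ ⊕ₗ P₂) :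
    toggleGroup (chains P₁) × toggleGroup (chains P₂) ≃* toggleGroup (chains P) :=
  (Subgroup.prodEquiv _ _).symm.trans <|
    (Subgroup.equivMapOfInjective _ _ (permProdHom_injective e)).trans
      (MulEquiv.subgroupCongr (map_permProdHom e))

theorem toggleGroupProdEquiv_apply (e : P ≃o P₁ ⊕ₗ P₂)
    (g : toggleGroup (chains P₁) × toggleGroup (chains P₂)) (C : chains P₁ × chains P₂) :
    (toggleGroupProdEquiv e g).1 (chainsProdEquiv e C) =
      chainsProdEquiv e (g.1.1 C.1, g.2.1 C.2) :=
  permProdHom_apply e (g.1.1, g.2.1) C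

end Products

end ToggleGroups

/-- For a finite poset `P`:
* if `e` identifies `P` with the ordinal sum `P₁ ⊕ₗ P₂`, then `(C₁, C₂) ↦ C₁ ∪ C₂` is a bijection
  `b` from pairs of chains to chains of `P`, and, through `b`, the toggle group of the chains of `P`
  is the direct product of those of `P₁` and `P₂`, acting componentwise;
* if `P` is not an ordinal sum of two nonempty posets, its chain family is toggle-alternating. -/
theorem mainTheorem4 {P : Type*} [PartialOrder P] [Finite P] :
    (∀ {P₁ P₂ : Type*} [PartialOrder P₁] [PartialOrder P₂] (e : P ≃o P₁ ⊕ₗ P₂),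
      ∃ (b : ToggleGroups.chains P₁ × ToggleGroups.chains P₂ ≃ ToggleGroups.chains P)
        (φ : ToggleGroups.toggleGroup (ToggleGroups.chains P) ≃*
          ToggleGroups.toggleGroup (ToggleGroups.chains P₁) ×
            ToggleGroups.toggleGroup (ToggleGroups.chains P₂)),
        (∀ (C₁ : ToggleGroups.chains P₁) (C₂ : ToggleGroups.chains P₂),
          (b (C₁, C₂)).1 =
            (fun p => e.symm (Sum.inlₗ p)) '' C₁.1 ∪ (fun p => e.symm (Sum.inrₗ p)) '' C₂.1) ∧
        (∀ (g : ToggleGroups.toggleGroup (ToggleGroups.chains P))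
          (C₁ : ToggleGroups.chains P₁) (C₂ : ToggleGroups.chains P₂),
          g.1 (b (C₁, C₂)) = b ((φ g).1.1 C₁, (φ g).2.1 C₂))) ∧
    (¬ ToggleGroups.IsOrdinalSum P →
      ToggleGroups.ToggleAlternating (ToggleGroups.chains P)) := by
  refine ⟨fun {P₁ P₂} _ _ e => ⟨ToggleGroups.chainsProdEquiv e,
    (ToggleGroups.toggleGroupProdEquiv e).symm, fun _ _ => rfl, fun g C₁ C₂ => ?_⟩,
    ToggleGroups.toggleAlternating_chains⟩
  rw [← ToggleGroups.toggleGroupProdEquiv_apply e _ (C₁, C₂), MulEquiv.apply_symm_apply]
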